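/- Let $G=(V,E)$ be a finite simple graph with a 1-planar drawing in the plane, that is, a drawing in which distinct vertices are distinct points, every edge is a simple curve joining its two end vertices and containing no other vertex, and every edge is crossed at most once (by at most one other edge, in at most one point). If the planar skeleton of the drawing, i.e. the graph on $V$ obtained from $G$ by deleting all crossed edges, has a Hamiltonian cycle, then $G$ has a 4-page book embedding: there are a linear ordering $<$ of $V$ and an assignment of each edge of $G$ to one of four pages such that no two edges $\{u,v\}$ and $\{x,y\}$ with $u<x<v<y$ are assigned to the same page. -/

import Mathlib

/-- The Euclidean plane. -/
abbrev Plane : Type := EuclideanSpace ℝ (Fin 2)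

/-- A drawing of a simple graph in the plane: vertices are placed at distinct points, every edge is
a simple curve (Jordan arc) joining the points of its two end vertices, and no edge passes through
a vertex in its interior. Different edges may meet. -/
structure PlaneDrawing {V : Type*} (G : SimpleGraph V) where
  point : V → Plane
  point_injective : Function.Injective point
  arc : G.edgeSet → C(unitInterval, Plane)
  arc_injective : ∀ e, Function.Injective (arc e)
  arc_ends : ∀ e, s(arc e 0, arc e 1) = Sym2.map point (e : Sym2 V)
  arc_avoids : ∀ e v t, arc e t = point v → t = 0 ∨ t = 1

namespace PlaneDrawing

variable {V : Type*} {G : SimpleGraph V} (D : PlaneDrawing G)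

/-- The open arc of an edge, i.e. its curve without the two end points. -/
def openArc (e : G.edgeSet) : Set Plane := D.arc e '' Set.Ioo 0 1

/-- The distinct edges `e` and `f` cross at the point `x`: it lies in the interior of both. -/
def CrossAt (e f : G.edgeSet) (x : Plane) : Prop :=
  e ≠ f ∧ x ∈ D.openArc e ∧ x ∈ D.openArc f

/-- The edge `e` is crossed by some other edge. -/
def IsCrossed (e : G.edgeSet) : Prop := ∃ f x, D.CrossAt e f x

/-- The drawing is 1-planar: every edge is crossed at most once, i.e. by at most one other edge
and in at most one point. -/
def IsOnePlanar : Prop :=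
  ∀ e f g x y, D.CrossAt e f x → D.CrossAt e g y → f = g ∧ x = y

/-- The planar skeleton: all vertices of `G`, with all crossed edges deleted. -/
def skeleton : SimpleGraph V := G.deleteEdges (Subtype.val '' {e : G.edgeSet | D.IsCrossed e})

end PlaneDrawing

/-- Two edges twist in a linear ordering of the vertices if their end vertices alternate. -/
def Twist {V : Type*} (L : LinearOrder V) (e f : Sym2 V) : Prop :=
  ∃ u v x y : V, e = s(u, v) ∧ f = s(x, y) ∧
    ((L.lt u x ∧ L.lt x v ∧ L.lt v y) ∨ (L.lt x u ∧ L.lt u y ∧ L.lt y v))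

/-- A `k`-page book embedding: a linear ordering of the vertices and an assignment of the edges to
`k` pages such that no two edges in the same page twist. -/
structure BookEmbedding {V : Type*} (G : SimpleGraph V) (k : ℕ) where
  order : LinearOrder V
  page : G.edgeSet → Fin k
  no_conflict : ∀ e f : G.edgeSet, page e = page f → ¬ Twist order (e : Sym2 V) (f : Sym2 V)

/-!
The vertices are ordered along the Hamiltonian cycle `C` of the skeleton. Every edge of `C` is
uncrossed, so `C` is drawn as a closed curve that no other edge meets, except at its end points.
The page of an edge consists of two bits.

* Its side of `C`: the parity of the winding number of `C` around the midpoint of the edge. Two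
  edges that twist and do not cross are disjoint chords of `C` with alternating end points, and such
  chords lie on different sides (`PlaneDrawing.exists_odd_add_winding_of_chords`).
* A 2-colouring of the edges that separates the two members of each crossing pair; it exists since
  each edge crosses at most one other edge (`PlaneDrawing.IsOnePlanar.exists_coloring`).

Two edges that twist either cross, and differ in the second bit, or do not, and differ in the first.

The statement on chords replaces the Jordan curve theorem, and follows from a parity argument with
angles. For a path `γ` and a point `z` off it, `logIncrement γ z` is the change of a continuous
logarithm of `γ t - z`. If `γ` and `δ` are disjoint, `γ s - δ t` has a continuous logarithm on the
unit square, and its total change around the boundary vanishes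
(`logIncrement_add_comm_of_disjoint`). In particular winding numbers are constant along curves that
avoid a closed path. So the winding number of `C` around a point of a chord is the sum of the
winding numbers of the two triangles into which the other chord divides `C`, each taken around the
end of the first chord that is not on it. For the two chords together this gives the sum, over the
four vertices of a drawing of `K₄` without crossings, of the winding number of the opposite triangle
around the vertex. That sum is odd (`exists_odd_sum_triangle_logIncrement`): the square relation for
the three pairs of disjoint edges determines it modulo `2`.
-/

open Set Complex unitInterval

/-! ### Continuous logarithms along paths -/

theorem exists_continuous_log {A : Type*} [TopologicalSpace A] [SimplyConnectedSpace A]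
    [LocallyPathConnectedSpace A] (f : C(A, ℂ)) (hf : ∀ a, f a ≠ 0) :
    ∃ F : C(A, ℂ), ∀ a, exp (F a) = f a := by
  obtain ⟨a₀⟩ : Nonempty A := inferInstance
  obtain ⟨F, ⟨-, hF⟩, -⟩ :=
    isCoveringMapOn_exp.existsUnique_continuousMap_lifts f (exp_log (hf a₀)) hf
  exact ⟨F, fun a => congrFun hF a⟩

instance : LocallyPathConnectedSpace I :=
  (convex_Icc (0 : ℝ) 1).locallyPathConnectedSpace

instance : ContractibleSpace I :=
  (convex_Icc (0 : ℝ) 1).contractibleSpace ⟨0, by simp⟩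

/-- The change of a continuous logarithm of `γ t - z` as `t` runs from `0` to `1`; its imaginary
part is the angle through which `γ` turns around `z`. The value is `0` if `z` lies on `γ`. -/
noncomputable def logIncrement {a b : ℂ} (γ : Path a b) (z : ℂ) : ℂ :=
  open Classical in
  if h : ∃ F : C(I, ℂ), ∀ t, exp (F t) = γ t - z then h.choose 1 - h.choose 0 else 0

section

variable {a b c u v : ℂ}

theorem exists_log_sub (γ : Path a b) {z : ℂ} (hz : z ∉ range γ) :
    ∃ F : C(I, ℂ), ∀ t, exp (F t) = γ t - z :=
  exists_continuous_log ⟨fun t => γ t - z, by fun_prop⟩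
    fun t => sub_ne_zero.2 fun h => hz ⟨t, h⟩

theorem logIncrement_eq (γ : Path a b) {z : ℂ} (F : C(I, ℂ)) (hF : ∀ t, exp (F t) = γ t - z) :
    logIncrement γ z = F 1 - F 0 := by
  have h : ∃ F : C(I, ℂ), ∀ t, exp (F t) = γ t - z := ⟨F, hF⟩
  rw [logIncrement, dif_pos h]
  generalize h.choose = K, h.choose_spec = hK
  have hz : ∀ t, γ t - z ≠ 0 := fun t => hF t ▸ exp_ne_zero _
  obtain ⟨G, -, hG⟩ := isCoveringMapOn_exp.existsUnique_continuousMap_lifts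
    (⟨fun t => γ t - z, by fun_prop⟩ : C(I, ℂ)) (hF 0) hz
  have h1 := hG F ⟨rfl, funext hF⟩
  -- `K` translated so that it agrees with `F` at `0` is another lift with the same initial value.
  have h2 := hG (K + ContinuousMap.const I (F 0 - K 0)) ⟨by simp, funext fun t => by
    have h0 : exp (F 0 - K 0) = 1 := by rw [exp_sub, hF, hK, div_self (hz 0)]
    simp [exp_add, hK, h0]⟩
  have h3 := congrArg (fun M : C(I, ℂ) => M 1) (h1.trans h2.symm)
  simp only [ContinuousMap.add_apply, ContinuousMap.const_apply] at h3
  rw [h3]; ring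

theorem exp_logIncrement (γ : Path a b) {z : ℂ} (hz : z ∉ range γ) :
    exp (logIncrement γ z) = (b - z) / (a - z) := by
  obtain ⟨F, hF⟩ := exists_log_sub γ hz
  rw [logIncrement_eq γ F hF, exp_sub, hF, hF, γ.source, γ.target]

/-- A logarithmic increment is determined by the end points up to a multiple of `2πi`. -/
theorem exists_logIncrement_eq (γ : Path a b) {z p q : ℂ} (hz : z ∉ range γ)
    (hp : exp p = a - z) (hq : exp q = b - z) :
    ∃ n : ℤ, logIncrement γ z = q - p + n * (2 * Real.pi * Complex.I) :=
  exp_eq_exp_iff_exists_int.1 <| by rw [exp_logIncrement γ hz, exp_sub, hp, hq]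

theorem logIncrement_symm (γ : Path a b) {z : ℂ} (hz : z ∉ range γ) :
    logIncrement γ.symm z = -logIncrement γ z := by
  obtain ⟨F, hF⟩ := exists_log_sub γ hz
  rw [logIncrement_eq γ F hF,
    logIncrement_eq γ.symm (F.comp ⟨σ, by fun_prop⟩) fun t => by simp [hF]]
  simp

theorem logIncrement_refl (a z : ℂ) : logIncrement (Path.refl a) z = 0 := by
  by_cases h : ∃ F : C(I, ℂ), ∀ t, exp (F t) = Path.refl a t - z
  · obtain ⟨F, hF⟩ := h
    rw [logIncrement_eq (Path.refl a) (ContinuousMap.const I (F 0)) fun t => by simp [hF]]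
    simp
  · rw [logIncrement, dif_neg h]

theorem logIncrement_trans (γ : Path a b) (δ : Path b c) {z : ℂ} (hγ : z ∉ range γ)
    (hδ : z ∉ range δ) :
    logIncrement (γ.trans δ) z = logIncrement γ z + logIncrement δ z := by
  have hz : z ∉ range (γ.trans δ) := by
    rw [Path.trans_range]; exact fun h => h.elim hγ hδ
  obtain ⟨F, hF⟩ := exists_log_sub _ hz
  have l : ∀ t : I, (t : ℝ) / 2 ∈ I := fun t => ⟨by linarith [t.2.1], by linarith [t.2.2]⟩
  have r : ∀ t : I, ((t : ℝ) + 1) / 2 ∈ I := fun t => ⟨by linarith [t.2.1], by linarith [t.2.2]⟩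
  have hl := logIncrement_eq γ (F.comp ⟨fun t => ⟨(t : ℝ) / 2, l t⟩, by fun_prop⟩) (z := z)
    fun t => by
      have : (t : ℝ) / 2 ≤ 1 / 2 := by linarith [t.2.2]
      simp only [ContinuousMap.comp_apply, ContinuousMap.coe_mk, hF, Path.trans_apply, this,
        dif_pos]
      congr 2; ext; ring_nf
  have hr := logIncrement_eq δ (F.comp ⟨fun t => ⟨((t : ℝ) + 1) / 2, r t⟩, by fun_prop⟩) (z := z)
    fun t => by
      simp only [ContinuousMap.comp_apply, ContinuousMap.coe_mk, hF]
      congr 1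
      rw [Path.trans_apply]
      split_ifs with h
      · have : t = 0 := by
          ext
          have h : ((t : ℝ) + 1) / 2 ≤ 1 / 2 := h
          simp only [Icc.coe_zero]
          linarith [t.2.1]
        subst this
        simp
      · congr 1; ext; ring_nf
  rw [logIncrement_eq _ F hF, hl, hr]
  have e1 : (⟨((0 : I) : ℝ) / 2, l 0⟩ : I) = 0 := by ext; simp
  have e2 : (⟨((1 : I) : ℝ) / 2, l 1⟩ : I) = ⟨(((0 : I) : ℝ) + 1) / 2, r 0⟩ := by ext; simp
  have e3 : (⟨(((1 : I) : ℝ) + 1) / 2, r 1⟩ : I) = 1 := by ext; simp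
  simp only [ContinuousMap.comp_apply, ContinuousMap.coe_mk, e1, e2, e3]
  ring

/-- For disjoint paths `γ` and `δ`, a continuous logarithm of `γ s - δ t` on the unit square has
total change zero around the boundary of the square. -/
theorem logIncrement_add_comm_of_disjoint (γ : Path a b) (δ : Path u v)
    (h : Disjoint (range γ) (range δ)) :
    logIncrement γ u + logIncrement δ b = logIncrement γ v + logIncrement δ a := by
  obtain ⟨F, hF⟩ := exists_continuous_log
    (⟨fun x => γ x.1 - δ x.2, by fun_prop⟩ : C(I × I, ℂ))
    fun x => sub_ne_zero.2 fun e => disjoint_left.1 h ⟨x.1, rfl⟩ ⟨x.2, e.symm⟩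
  have hγ (t : I) : logIncrement γ (δ t) = F (1, t) - F (0, t) :=
    logIncrement_eq γ (F.comp ⟨fun s => (s, t), by fun_prop⟩) fun s => hF (s, t)
  have hδ (s : I) : logIncrement δ (γ s) = F (s, 1) - F (s, 0) := by
    rw [logIncrement_eq δ (F.comp ⟨fun t => (s, t), by fun_prop⟩ + ContinuousMap.const I (Real.pi * Complex.I))
      fun t => by simp [exp_add, hF]]
    simp
  have h1 := hγ 0
  have h2 := hγ 1
  have h3 := hδ 0
  have h4 := hδ 1
  simp only [Path.source, Path.target] at h1 h2 h3 h4
  rw [h1, h2, h3, h4]; ring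

/-- The logarithmic increment of a closed path is constant along any curve that avoids it. -/
theorem logIncrement_loop_congr (L : Path a a) (γ : Path u v) (s t : I)
    (h : Disjoint (range L) (γ '' uIcc s t)) : logIncrement L (γ s) = logIncrement L (γ t) := by
  simpa using logIncrement_add_comm_of_disjoint L (γ.subpath s t) (by rwa [Path.range_subpath])

end

/-! ### Two chords of a closed curve -/

theorem exists_exp_eq_sub {z w : ℂ} (h : w ≠ z) : ∃ p, exp p = w - z :=
  ⟨log (w - z), exp_log (sub_ne_zero.2 h)⟩

theorem exp_add_pi_mul_I_eq_sub {z w p : ℂ} (h : exp p = w - z) :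
    exp (p + Real.pi * Complex.I) = z - w := by
  rw [exp_add, exp_pi_mul_I, h]; ring

/-- The winding number of a closed path made of three pieces is constant along a curve avoiding
it. -/
theorem logIncrement_triangle_congr {p q r u v : ℂ} (A : Path p q) (B : Path q r) (C : Path r p)
    (γ : Path u v) (s t : I)
    (h : ∀ w ∈ uIcc s t, γ w ∉ range A ∧ γ w ∉ range B ∧ γ w ∉ range C) :
    logIncrement A (γ s) + logIncrement B (γ s) + logIncrement C (γ s) =
      logIncrement A (γ t) + logIncrement B (γ t) + logIncrement C (γ t) := by
  have expand {w : I} (hw : w ∈ uIcc s t) : logIncrement ((A.trans B).trans C) (γ w) =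
      logIncrement A (γ w) + logIncrement B (γ w) + logIncrement C (γ w) := by
    obtain ⟨hA, hB, hC⟩ := h w hw
    rw [logIncrement_trans _ _ _ hC, logIncrement_trans _ _ hA hB]
    rw [Path.trans_range]
    exact fun h => h.elim hA hB
  rw [← expand left_mem_uIcc, ← expand right_mem_uIcc]
  refine logIncrement_loop_congr _ γ s t (disjoint_right.2 ?_)
  rintro _ ⟨w, hw, rfl⟩
  obtain ⟨hA, hB, hC⟩ := h w hw
  rw [Path.trans_range, Path.trans_range]
  exact fun h => h.elim (fun h => h.elim hA hB) hC

section

variable {a x b y : ℂ} (P : Path a x) (Q : Path x b) (R : Path b y) (S : Path y a)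
  (γ : Path a b) (δ : Path x y)

/-- In a drawing of `K₄` in which disjoint edges do not meet, the winding numbers of the four
triangles around their opposite vertices have an odd sum. Each of the twelve increments of an edge
around a vertex is a difference of two fixed logarithms of vertex differences, up to a multiple of
`2πi`. The three relations coming from the pairs of disjoint edges then determine the parity of the
sum of these multiples; it is odd because reversing a vertex difference adds `πi` to its
logarithm. -/
theorem exists_odd_sum_triangle_logIncrement (hPR : Disjoint (range P) (range R))
    (hQS : Disjoint (range Q) (range S)) (hγδ : Disjoint (range γ) (range δ)) :
    ∃ k : ℤ, Odd k ∧
      (logIncrement Q a + logIncrement R a - logIncrement δ a) +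
      (logIncrement δ b + logIncrement S b + logIncrement P b) +
      (logIncrement P y + logIncrement Q y - logIncrement γ y) +
      (logIncrement γ x + logIncrement R x + logIncrement S x) =
      k * (2 * Real.pi * Complex.I) := by
  have nPR {z : ℂ} (hz : z ∈ range P) : z ∉ range R := disjoint_left.1 hPR hz
  have nRP {z : ℂ} (hz : z ∈ range R) : z ∉ range P := disjoint_right.1 hPR hz
  have nQS {z : ℂ} (hz : z ∈ range Q) : z ∉ range S := disjoint_left.1 hQS hz
  have nSQ {z : ℂ} (hz : z ∈ range S) : z ∉ range Q := disjoint_right.1 hQS hz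
  have nγδ {z : ℂ} (hz : z ∈ range γ) : z ∉ range δ := disjoint_left.1 hγδ hz
  have nδγ {z : ℂ} (hz : z ∈ range δ) : z ∉ range γ := disjoint_right.1 hγδ hz
  obtain ⟨ax, hax⟩ : ∃ p, exp p = x - a :=
    exists_exp_eq_sub fun h => nγδ γ.source_mem_range (h ▸ δ.source_mem_range)
  obtain ⟨ab, hab⟩ : ∃ p, exp p = b - a :=
    exists_exp_eq_sub fun h => nPR P.source_mem_range (h ▸ R.source_mem_range)
  obtain ⟨ay, hay⟩ : ∃ p, exp p = y - a :=
    exists_exp_eq_sub fun h => nγδ γ.source_mem_range (h ▸ δ.target_mem_range)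
  obtain ⟨xb, hxb⟩ : ∃ p, exp p = b - x :=
    exists_exp_eq_sub fun h => nδγ δ.source_mem_range (h ▸ γ.target_mem_range)
  obtain ⟨xy, hxy⟩ : ∃ p, exp p = y - x :=
    exists_exp_eq_sub fun h => nPR P.target_mem_range (h ▸ R.target_mem_range)
  obtain ⟨b_y, hby⟩ : ∃ p, exp p = y - b :=
    exists_exp_eq_sub fun h => nγδ γ.target_mem_range (h ▸ δ.target_mem_range)
  have hxa := exp_add_pi_mul_I_eq_sub hax
  have hba := exp_add_pi_mul_I_eq_sub hab
  have hya := exp_add_pi_mul_I_eq_sub hay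
  have hbx := exp_add_pi_mul_I_eq_sub hxb
  have hyx := exp_add_pi_mul_I_eq_sub hxy
  have hyb := exp_add_pi_mul_I_eq_sub hby
  obtain ⟨n₁, h₁⟩ := exists_logIncrement_eq Q (nSQ S.target_mem_range) hax hab
  obtain ⟨n₂, h₂⟩ := exists_logIncrement_eq R (nPR P.source_mem_range) hab hay
  obtain ⟨n₃, h₃⟩ := exists_logIncrement_eq δ (nγδ γ.source_mem_range) hax hay
  obtain ⟨n₄, h₄⟩ := exists_logIncrement_eq δ (nγδ γ.target_mem_range) hbx hby
  obtain ⟨n₅, h₅⟩ := exists_logIncrement_eq S (nQS Q.target_mem_range) hby hba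
  obtain ⟨n₆, h₆⟩ := exists_logIncrement_eq P (nRP R.source_mem_range) hba hbx
  obtain ⟨n₇, h₇⟩ := exists_logIncrement_eq P (nRP R.target_mem_range) hya hyx
  obtain ⟨n₈, h₈⟩ := exists_logIncrement_eq Q (nSQ S.source_mem_range) hyx hyb
  obtain ⟨n₉, h₉⟩ := exists_logIncrement_eq γ (nδγ δ.target_mem_range) hya hyb
  obtain ⟨n₁₀, h₁₀⟩ := exists_logIncrement_eq γ (nδγ δ.source_mem_range) hxa hxb
  obtain ⟨n₁₁, h₁₁⟩ := exists_logIncrement_eq R (nPR P.target_mem_range) hxb hxy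
  obtain ⟨n₁₂, h₁₂⟩ := exists_logIncrement_eq S (nQS Q.source_mem_range) hxy hxa
  have r₁ := logIncrement_add_comm_of_disjoint P R hPR
  have r₂ := logIncrement_add_comm_of_disjoint Q S hQS
  have r₃ := logIncrement_add_comm_of_disjoint γ δ hγδ
  have hpi : (2 * Real.pi * Complex.I : ℂ) ≠ 0 := by simp [Real.pi_ne_zero]
  have e₁ : n₆ + n₁₁ = n₇ + n₂ := by
    have : (n₆ + n₁₁ : ℂ) = n₇ + n₂ := mul_right_cancel₀ hpi (by
      linear_combination r₁ - h₆ - h₁₁ + h₇ + h₂)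
    exact_mod_cast this
  have e₂ : n₈ + n₅ = n₁ + n₁₂ := by
    have : (n₈ + n₅ : ℂ) = n₁ + n₁₂ := mul_right_cancel₀ hpi (by
      linear_combination r₂ - h₈ - h₅ + h₁ + h₁₂)
    exact_mod_cast this
  have e₃ : n₁₀ + n₄ = n₉ + n₃ + 1 := by
    have : (n₁₀ + n₄ : ℂ) = n₉ + n₃ + 1 := mul_right_cancel₀ hpi (by
      linear_combination r₃ - h₁₀ - h₄ + h₉ + h₃)
    exact_mod_cast this
  refine ⟨n₁ + n₂ - n₃ + n₄ + n₅ + n₆ + n₇ + n₈ - n₉ + n₁₀ + n₁₁ + n₁₂,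
    ⟨n₇ + n₂ + n₁ + n₁₂, by linarith⟩, ?_⟩
  push_cast
  linear_combination h₁ + h₂ - h₃ + h₄ + h₅ + h₆ + h₇ + h₈ - h₉ + h₁₀ + h₁₁ + h₁₂

theorem Path.notMem_of_mem_uIcc_zero {u v : ℂ} (γ : Path u v) {X : Set ℂ} (hu : u ∉ X)
    (hγ : ∀ t ∈ Ioo (0 : I) 1, γ t ∉ X) {s r : I} (hs : s ∈ Ioo (0 : I) 1) (hr : r ∈ uIcc 0 s) :
    γ r ∉ X := by
  rw [uIcc_of_le hs.1.le] at hr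
  rcases hr.1.eq_or_lt with h | h
  · rwa [← h, γ.source]
  · exact hγ r ⟨h, hr.2.trans_lt hs.2⟩

theorem Path.notMem_of_mem_uIcc_one {u v : ℂ} (γ : Path u v) {X : Set ℂ} (hv : v ∉ X)
    (hγ : ∀ t ∈ Ioo (0 : I) 1, γ t ∉ X) {s r : I} (hs : s ∈ Ioo (0 : I) 1) (hr : r ∈ uIcc s 1) :
    γ r ∉ X := by
  rw [uIcc_of_le hs.2.le] at hr
  rcases hr.2.eq_or_lt with h | h
  · rwa [h, γ.target]
  · exact hγ r ⟨hs.1.trans_le hr.1, h⟩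

/-- Disjoint chords `γ` and `δ` of a closed curve `PQRS`, with alternating end points, lie on
different sides of it: the winding numbers of the curve around points `γ s` and `δ t` inside the
chords differ in parity. -/
theorem exists_odd_add_logIncrement_of_chords (hPR : Disjoint (range P) (range R))
    (hQS : Disjoint (range Q) (range S)) (hγδ : Disjoint (range γ) (range δ))
    (hγ : ∀ t ∈ Ioo (0 : I) 1,
      γ t ∉ range P ∧ γ t ∉ range Q ∧ γ t ∉ range R ∧ γ t ∉ range S)
    (hδ : ∀ t ∈ Ioo (0 : I) 1,
      δ t ∉ range P ∧ δ t ∉ range Q ∧ δ t ∉ range R ∧ δ t ∉ range S)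
    {s t : I} (hs : s ∈ Ioo (0 : I) 1) (ht : t ∈ Ioo (0 : I) 1) :
    ∃ m n : ℤ, Odd (m + n) ∧
      logIncrement P (γ s) + logIncrement Q (γ s) + logIncrement R (γ s) + logIncrement S (γ s) =
        m * (2 * Real.pi * Complex.I) ∧
      logIncrement P (δ t) + logIncrement Q (δ t) + logIncrement R (δ t) + logIncrement S (δ t) =
        n * (2 * Real.pi * Complex.I) := by
  have hpi : (2 * Real.pi * Complex.I : ℂ) ≠ 0 := by simp [Real.pi_ne_zero]
  obtain ⟨k, hk, hsum⟩ := exists_odd_sum_triangle_logIncrement P Q R S γ δ hPR hQS hγδ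
  -- The winding number of the whole curve is an integer.
  have int {z : ℂ} (hz : z ∉ range P ∧ z ∉ range Q ∧ z ∉ range R ∧ z ∉ range S) : ∃ m : ℤ,
      logIncrement P z + logIncrement Q z + logIncrement R z + logIncrement S z =
        m * (2 * Real.pi * Complex.I) := by
    obtain ⟨hP, hQ, hR, hS⟩ := hz
    refine exp_eq_one_iff.1 ?_
    have ha : a - z ≠ 0 := sub_ne_zero.2 fun h => hP (h ▸ P.source_mem_range)
    have hx : x - z ≠ 0 := sub_ne_zero.2 fun h => hP (h ▸ P.target_mem_range)
    have hb : b - z ≠ 0 := sub_ne_zero.2 fun h => hR (h ▸ R.source_mem_range)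
    have hy : y - z ≠ 0 := sub_ne_zero.2 fun h => hR (h ▸ R.target_mem_range)
    rw [exp_add, exp_add, exp_add, exp_logIncrement P hP, exp_logIncrement Q hQ,
      exp_logIncrement R hR, exp_logIncrement S hS]
    field_simp
  obtain ⟨m, hm⟩ := int (hγ s hs)
  obtain ⟨n, hn⟩ := int (hδ t ht)
  refine ⟨m, n, ?_, hm, hn⟩
  suffices h : k = m + n by rwa [← h]
  -- Before `s`, the chord `γ` avoids the triangle `QRδ`, after `s` it avoids the triangle `δSP`;
  -- similarly for `δ` and the triangles `RSγ` and `PQγ`.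
  have γ₁ {r : I} (hr : r ∈ uIcc 0 s) : γ r ∉ range Q ∧ γ r ∉ range R ∧ γ r ∉ range δ :=
    ⟨γ.notMem_of_mem_uIcc_zero (disjoint_right.1 hQS S.target_mem_range) (fun t h => (hγ t h).2.1)
      hs hr, γ.notMem_of_mem_uIcc_zero (disjoint_left.1 hPR P.source_mem_range)
      (fun t h => (hγ t h).2.2.1) hs hr, disjoint_left.1 hγδ ⟨r, rfl⟩⟩
  have γ₂ {r : I} (hr : r ∈ uIcc s 1) : γ r ∉ range δ ∧ γ r ∉ range S ∧ γ r ∉ range P :=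
    ⟨disjoint_left.1 hγδ ⟨r, rfl⟩, γ.notMem_of_mem_uIcc_one
      (disjoint_left.1 hQS Q.target_mem_range) (fun t h => (hγ t h).2.2.2) hs hr,
      γ.notMem_of_mem_uIcc_one (disjoint_right.1 hPR R.source_mem_range)
      (fun t h => (hγ t h).1) hs hr⟩
  have δ₁ {r : I} (hr : r ∈ uIcc 0 t) : δ r ∉ range γ ∧ δ r ∉ range R ∧ δ r ∉ range S :=
    ⟨disjoint_right.1 hγδ ⟨r, rfl⟩, δ.notMem_of_mem_uIcc_zero
      (disjoint_left.1 hPR P.target_mem_range) (fun t h => (hδ t h).2.2.1) ht hr,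
      δ.notMem_of_mem_uIcc_zero (disjoint_left.1 hQS Q.source_mem_range)
      (fun t h => (hδ t h).2.2.2) ht hr⟩
  have δ₂ {r : I} (hr : r ∈ uIcc t 1) : δ r ∉ range P ∧ δ r ∉ range Q ∧ δ r ∉ range γ :=
    ⟨δ.notMem_of_mem_uIcc_one (disjoint_right.1 hPR R.target_mem_range) (fun t h => (hδ t h).1)
      ht hr, δ.notMem_of_mem_uIcc_one (disjoint_right.1 hQS S.source_mem_range)
      (fun t h => (hδ t h).2.1) ht hr, disjoint_right.1 hγδ ⟨r, rfl⟩⟩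
  have w₁ := logIncrement_triangle_congr Q R δ.symm γ 0 s fun r hr => by
    simpa only [Path.symm_range] using γ₁ hr
  have w₂ := logIncrement_triangle_congr δ S P γ s 1 fun r hr => γ₂ hr
  have w₃ := logIncrement_triangle_congr γ R S δ 0 t fun r hr => δ₁ hr
  have w₄ := logIncrement_triangle_congr P Q γ.symm δ t 1 fun r hr => by
    simpa only [Path.symm_range] using δ₂ hr
  have γ₀ := (γ₁ left_mem_uIcc).2.2
  have γs := (γ₁ right_mem_uIcc).2.2
  have δ₀ := (δ₂ right_mem_uIcc).2.2
  have δt := (δ₂ left_mem_uIcc).2.2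
  rw [logIncrement_symm _ γ₀, logIncrement_symm _ γs] at w₁
  rw [logIncrement_symm _ δ₀, logIncrement_symm _ δt] at w₄
  simp only [Path.source, Path.target] at w₁ w₂ w₃ w₄
  have : (k : ℂ) = m + n := mul_right_cancel₀ hpi (by
    linear_combination hm + hn - hsum + w₁ - w₂ + w₃ - w₄)
  exact_mod_cast this

end

/-! ### Drawings transported to the complex plane -/

namespace PlaneDrawing

variable {V : Type*} {G : SimpleGraph V} (D : PlaneDrawing G)

/-- The isometry of the Euclidean plane with `ℂ` given by the basis `1, i`. -/
noncomputable def toComplex : Plane ≃ₗᵢ[ℝ] ℂ := orthonormalBasisOneI.repr.symm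

/-- The point of a vertex, as a complex number. -/
noncomputable def cpoint (v : V) : ℂ := toComplex (D.point v)

/-- The closed arc of an edge, as a set of complex numbers. -/
def carc (e : G.edgeSet) : Set ℂ := toComplex '' range (D.arc e)

/-- The open arc of an edge, as a set of complex numbers. -/
def cOpenArc (e : G.edgeSet) : Set ℂ := toComplex '' D.openArc e

/-- The midpoint, in the given parametrization, of the arc of an edge. -/
noncomputable def midpoint (e : G.edgeSet) : ℂ :=
  toComplex (D.arc e ⟨1 / 2, by norm_num, by norm_num⟩)

variable {D}

theorem midpoint_mem_cOpenArc (e : G.edgeSet) : D.midpoint e ∈ D.cOpenArc e :=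
  ⟨_, ⟨_, ⟨Subtype.coe_lt_coe.1 (by norm_num), Subtype.coe_lt_coe.1 (by norm_num)⟩, rfl⟩, rfl⟩

theorem cpoint_notMem_cOpenArc (e : G.edgeSet) (v : V) : D.cpoint v ∉ D.cOpenArc e := by
  rintro ⟨_, ⟨t, ht, rfl⟩, h⟩
  rcases D.arc_avoids e v t (toComplex.injective h) with rfl | rfl
  · exact lt_irrefl _ ht.1
  · exact lt_irrefl _ ht.2

variable (D) in
/-- The arc of an edge can be traversed in either direction. -/
theorem exists_path {u v : V} (h : G.Adj u v) : ∃ γ : Path (D.cpoint u) (D.cpoint v),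
    range γ = D.carc ⟨s(u, v), h⟩ ∧ γ '' Ioo 0 1 = D.cOpenArc ⟨s(u, v), h⟩ := by
  set e : G.edgeSet := ⟨s(u, v), h⟩ with he
  let f : Path (toComplex (D.arc e 0)) (toComplex (D.arc e 1)) :=
    ⟨⟨fun t => toComplex (D.arc e t), by fun_prop⟩, rfl, rfl⟩
  have hr : range f = D.carc e := range_comp toComplex (D.arc e)
  have ho : f '' Ioo 0 1 = D.cOpenArc e := image_comp toComplex (D.arc e) _
  have hends := D.arc_ends e
  simp only [he, Sym2.map_mk, Sym2.eq_iff] at hends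
  rw [← he] at hends
  rcases hends with ⟨h0, h1⟩ | ⟨h0, h1⟩
  · refine ⟨f.cast (congrArg toComplex h0.symm) (congrArg toComplex h1.symm), ?_⟩
    exact ⟨hr, ho⟩
  · refine ⟨f.symm.cast (congrArg toComplex h1.symm) (congrArg toComplex h0.symm), ?_⟩
    refine ⟨f.symm_range.trans hr, ?_⟩
    rw [← ho]
    have : (σ '' Ioo 0 1 : Set I) = Ioo 0 1 := by
      ext t
      constructor
      · rintro ⟨s, hs, rfl⟩
        exact ⟨by simpa using symm_lt_symm.2 hs.2, by simpa using symm_lt_symm.2 hs.1⟩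
      · exact fun ht => ⟨σ t, ⟨by simpa using symm_lt_symm.2 ht.2,
          by simpa using symm_lt_symm.2 ht.1⟩, by simp⟩
    conv_rhs => rw [← this, ← image_comp]
    rfl

theorem mem_carc_iff {e : G.edgeSet} {z : ℂ} :
    z ∈ D.carc e ↔ z ∈ D.cOpenArc e ∨ ∃ w ∈ (e : Sym2 V), z = D.cpoint w := by
  obtain ⟨⟨u, v⟩, h⟩ := e
  obtain ⟨γ, hr, ho⟩ := D.exists_path h
  change z ∈ D.carc ⟨s(u, v), h⟩ ↔ z ∈ D.cOpenArc ⟨s(u, v), h⟩ ∨ ∃ w ∈ s(u, v), _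
  rw [← hr, ← ho]
  constructor
  · rintro ⟨t, rfl⟩
    rcases eq_or_ne t 0 with rfl | h0
    · exact Or.inr ⟨u, by simp, γ.source⟩
    rcases eq_or_ne t 1 with rfl | h1
    · exact Or.inr ⟨v, by simp, γ.target⟩
    exact Or.inl ⟨t, ⟨pos_iff_ne_zero.2 h0, unitInterval.lt_one_iff_ne_one.2 h1⟩, rfl⟩
  · rintro (⟨t, -, rfl⟩ | ⟨w, hw, rfl⟩)
    · exact ⟨t, rfl⟩
    · rcases Sym2.mem_iff.1 hw with rfl | rfl
      exacts [γ.source_mem_range, γ.target_mem_range]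

theorem disjoint_cOpenArc {e f : G.edgeSet} (hne : e ≠ f) (h : ∀ x, ¬ D.CrossAt e f x) :
    Disjoint (D.cOpenArc e) (D.cOpenArc f) := by
  rw [disjoint_left]
  rintro _ ⟨p, hp, rfl⟩ ⟨q, hq, hpq⟩
  obtain rfl := toComplex.injective hpq
  exact h q ⟨hne, hp, hq⟩

theorem disjoint_cOpenArc_carc {e f : G.edgeSet} (hne : e ≠ f) (h : ∀ x, ¬ D.CrossAt e f x) :
    Disjoint (D.cOpenArc e) (D.carc f) := by
  refine disjoint_left.2 fun z he hf => ?_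
  rcases mem_carc_iff.1 hf with hf | ⟨w, -, rfl⟩
  · exact disjoint_left.1 (disjoint_cOpenArc hne h) he hf
  · exact cpoint_notMem_cOpenArc e w he

theorem disjoint_carc {e f : G.edgeSet} (hne : ∀ w ∈ (e : Sym2 V), w ∉ (f : Sym2 V))
    (h : ∀ x, ¬ D.CrossAt e f x) : Disjoint (D.carc e) (D.carc f) := by
  have hef : e ≠ f := by
    rintro rfl
    exact hne _ (Sym2.out_fst_mem _) (Sym2.out_fst_mem _)
  refine disjoint_left.2 fun z he hf => ?_
  rcases mem_carc_iff.1 he with he' | ⟨w, hw, rfl⟩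
  · exact disjoint_left.1 (disjoint_cOpenArc_carc hef h) he' hf
  rcases mem_carc_iff.1 hf with hf | ⟨w', hw', hww'⟩
  · exact cpoint_notMem_cOpenArc f w hf
  · obtain rfl := D.point_injective (toComplex.injective hww')
    exact hne w hw hw'

theorem CrossAt.symm {e f : G.edgeSet} {x : Plane} (h : D.CrossAt e f x) : D.CrossAt f e x :=
  ⟨h.1.symm, h.2.2, h.2.1⟩

end PlaneDrawing

/-! ### Chords of a Hamiltonian cycle -/

/-- Concatenation of consecutive paths. -/
theorem exists_path_of_chain (x : ℕ → ℂ) (c : ∀ t, Path (x t) (x (t + 1))) {i j : ℕ}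
    (hij : i ≤ j) : ∃ P : Path (x i) (x j),
      (∀ z ∈ range P, z = x i ∨ ∃ t, i ≤ t ∧ t < j ∧ z ∈ range (c t)) ∧
      ∀ z, (∀ t, i ≤ t → t < j → z ∉ range (c t)) → z ≠ x i →
        logIncrement P z = ∑ t ∈ Finset.Ico i j, logIncrement (c t) z := by
  induction j, hij using Nat.le_induction with
  | base => exact ⟨Path.refl _, by simp, by simp [logIncrement_refl]⟩
  | succ j hij ih =>
    obtain ⟨P, hP, hL⟩ := ih
    refine ⟨P.trans (c j), fun z hz => ?_, fun z hz hi => ?_⟩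
    · rw [Path.trans_range] at hz
      rcases hz with hz | hz
      · exact (hP z hz).imp_right fun ⟨t, h1, h2, h3⟩ => ⟨t, h1, h2.trans j.lt_succ_self, h3⟩
      · exact Or.inr ⟨j, hij, j.lt_succ_self, hz⟩
    · rw [logIncrement_trans _ _ _ (hz j hij j.lt_succ_self),
        hL z (fun t h1 h2 => hz t h1 (h2.trans j.lt_succ_self)) hi,
        Finset.sum_Ico_succ_top hij]
      intro h
      exact (hP z h).elim hi fun ⟨t, h1, h2, h3⟩ => hz t h1 (h2.trans j.lt_succ_self) h3

namespace PlaneDrawing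

variable {V : Type*} {G : SimpleGraph V} {D : PlaneDrawing G}

/-- Two chords of an uncrossed cycle whose end points alternate and which do not cross lie on
different sides of the cycle: its winding numbers around their midpoints differ in parity. -/
theorem exists_odd_add_winding_of_chords {n : ℕ} {v : ℕ → V} (hclosed : v n = v 0)
    (hv : ∀ p q, p < n → q < n → v p = v q → p = q)
    (adj : ∀ t < n, G.Adj (v t) (v (t + 1)))
    (unc : ∀ t (h : t < n), ¬ D.IsCrossed ⟨s(v t, v (t + 1)), adj t h⟩)
    (c : ∀ t, Path (D.cpoint (v t)) (D.cpoint (v (t + 1))))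
    (hc : ∀ t (h : t < n), range (c t) = D.carc ⟨s(v t, v (t + 1)), adj t h⟩)
    {i k j l : ℕ} (hik : i < k) (hkj : k < j) (hjl : j < l) (hln : l < n)
    (he : G.Adj (v i) (v j)) (hf : G.Adj (v k) (v l))
    (hcr : ∀ x, ¬ D.CrossAt ⟨s(v i, v j), he⟩ ⟨s(v k, v l), hf⟩ x) :
    ∃ m m' : ℤ, Odd (m + m') ∧
      ∑ t ∈ Finset.range n, logIncrement (c t) (D.midpoint ⟨s(v i, v j), he⟩) =
        m * (2 * Real.pi * Complex.I) ∧
      ∑ t ∈ Finset.range n, logIncrement (c t) (D.midpoint ⟨s(v k, v l), hf⟩) =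
        m' * (2 * Real.pi * Complex.I) := by
  have hv' : ∀ p q, p ≤ n → q ≤ n → v p = v q → p = q ∨ p = 0 ∧ q = n ∨ p = n ∧ q = 0 := by
    intro p q hp hq h
    rcases hp.lt_or_eq with hp | rfl <;> rcases hq.lt_or_eq with hq | rfl
    · exact Or.inl (hv p q hp hq h)
    · have := hv p 0 hp (by omega) (h.trans hclosed); omega
    · have := hv 0 q (by omega) hq (hclosed.symm.trans h); omega
    · exact Or.inl rfl
  have ends : ∀ t, D.cpoint (v t) ∈ range (c t) ∧ D.cpoint (v (t + 1)) ∈ range (c t) :=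
    fun t => ⟨(c t).source_mem_range, (c t).target_mem_range⟩
  obtain ⟨P, hP, hPL⟩ := exists_path_of_chain (fun t => D.cpoint (v t)) c hik.le
  obtain ⟨Q, hQ, hQL⟩ := exists_path_of_chain (fun t => D.cpoint (v t)) c hkj.le
  obtain ⟨R, hR, hRL⟩ := exists_path_of_chain (fun t => D.cpoint (v t)) c hjl.le
  obtain ⟨S₁, hS₁, hSL₁⟩ := exists_path_of_chain (fun t => D.cpoint (v t)) c hln.le
  obtain ⟨S₀, hS₀, hSL₀⟩ := exists_path_of_chain (fun t => D.cpoint (v t)) c (Nat.zero_le i)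
  set S := S₁.trans (S₀.cast (congrArg D.cpoint hclosed) rfl) with hS
  obtain ⟨γ, hγr, hγo⟩ := D.exists_path he
  obtain ⟨δ, hδr, hδo⟩ := D.exists_path hf
  -- Every point of the four arcs lies on one of their cycle edges.
  replace hP : ∀ z ∈ range P, ∃ t, i ≤ t ∧ t < k ∧ z ∈ range (c t) := fun z hz =>
    (hP z hz).elim (fun h => ⟨i, le_rfl, hik, h ▸ (ends i).1⟩) id
  replace hQ : ∀ z ∈ range Q, ∃ t, k ≤ t ∧ t < j ∧ z ∈ range (c t) := fun z hz =>
    (hQ z hz).elim (fun h => ⟨k, le_rfl, hkj, h ▸ (ends k).1⟩) id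
  replace hR : ∀ z ∈ range R, ∃ t, j ≤ t ∧ t < l ∧ z ∈ range (c t) := fun z hz =>
    (hR z hz).elim (fun h => ⟨j, le_rfl, hjl, h ▸ (ends j).1⟩) id
  have hS' : ∀ z ∈ range S, ∃ t, t < n ∧ (l ≤ t ∨ t < i) ∧ z ∈ range (c t) := by
    intro z hz
    rw [hS, Path.trans_range] at hz
    rcases hz with hz | hz
    · rcases hS₁ z hz with h | ⟨t, h1, h2, h3⟩
      · exact ⟨l, hln, Or.inl le_rfl, h ▸ (ends l).1⟩
      · exact ⟨t, h2, Or.inl h1, h3⟩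
    · rcases hS₀ z hz with h | ⟨t, -, h2, h3⟩
      · refine ⟨n - 1, by omega, Or.inl (by omega), ?_⟩
        have h' : z = D.cpoint (v (n - 1 + 1)) := by
          rw [h, ← hclosed, Nat.sub_add_cancel (by omega)]
        rw [h']
        exact (ends (n - 1)).2
      · exact ⟨t, by omega, Or.inr h2, h3⟩
  have cdisj : ∀ s t, s < n → t < n → (∀ p q, p = s ∨ p = s + 1 → q = t ∨ q = t + 1 →
      v p ≠ v q) → Disjoint (range (c s)) (range (c t)) := by
    intro s t hs ht h
    rw [hc s hs, hc t ht]
    refine disjoint_carc (fun w h1 h2 => ?_) fun x hx => unc s hs ⟨_, x, hx⟩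
    rcases Sym2.mem_iff.1 h1 with rfl | rfl <;> rcases Sym2.mem_iff.1 h2 with h2 | h2 <;>
      exact h _ _ (by simp) (by simp) h2
  -- A chord joins vertices that are not consecutive, so it is not an edge of the cycle.
  have chord : ∀ p q, p + 1 < q → q < n → (p ≠ 0 ∨ q + 1 ≠ n) → ∀ h : G.Adj (v p) (v q),
      ∀ z ∈ D.cOpenArc ⟨s(v p, v q), h⟩, ∀ t < n, z ∉ range (c t) := by
    intro p q hpq hq hpq' h z hz t ht hzt
    rw [hc t ht] at hzt
    refine disjoint_left.1 (disjoint_cOpenArc_carc (fun heq => ?_)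
      fun x hx => unc t ht ⟨_, x, hx.symm⟩) hz hzt
    rcases Sym2.eq_iff.1 (congrArg Subtype.val heq) with ⟨h1, h2⟩ | ⟨h1, h2⟩
    · have := hv' _ _ (by omega) (by omega) h1
      have := hv' _ _ (by omega) (by omega) h2
      omega
    · have := hv' _ _ (by omega) (by omega) h1
      have := hv' _ _ (by omega) (by omega) h2
      omega
  have off : ∀ z, (∀ t < n, z ∉ range (c t)) →
      z ∉ range P ∧ z ∉ range Q ∧ z ∉ range R ∧ z ∉ range S := by
    intro z hz
    refine ⟨fun h => ?_, fun h => ?_, fun h => ?_, fun h => ?_⟩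
    · obtain ⟨t, h1, h2, h3⟩ := hP z h; exact hz t (by omega) h3
    · obtain ⟨t, h1, h2, h3⟩ := hQ z h; exact hz t (by omega) h3
    · obtain ⟨t, h1, h2, h3⟩ := hR z h; exact hz t (by omega) h3
    · obtain ⟨t, h1, h2, h3⟩ := hS' z h; exact hz t h1 h3
  have total : ∀ z, (∀ t < n, z ∉ range (c t)) →
      logIncrement P z + logIncrement Q z + logIncrement R z + logIncrement S z =
        ∑ t ∈ Finset.range n, logIncrement (c t) z := by
    intro z hz
    have hne : ∀ t < n, z ≠ D.cpoint (v t) := fun t ht h => hz t ht (h ▸ (ends t).1)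
    obtain ⟨-, -, -, hzS⟩ := off z hz
    rw [hS, Path.trans_range, mem_union, not_or] at hzS
    rw [hS, logIncrement_trans _ _ hzS.1 hzS.2,
      hPL z (fun t _ _ => hz t (by omega)) (hne i (by omega)),
      hQL z (fun t _ _ => hz t (by omega)) (hne k (by omega)),
      hRL z (fun t _ _ => hz t (by omega)) (hne j (by omega)),
      hSL₁ z (fun t _ _ => hz t (by omega)) (hne l (by omega)),
      show logIncrement (S₀.cast (congrArg D.cpoint hclosed) rfl) z = logIncrement S₀ z from rfl,
      hSL₀ z (fun t _ _ => hz t (by omega)) (hne 0 (by omega)),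
      Finset.range_eq_Ico, ← Finset.sum_Ico_consecutive _ (Nat.zero_le i) (by omega : i ≤ n),
      ← Finset.sum_Ico_consecutive _ hik.le (by omega : k ≤ n),
      ← Finset.sum_Ico_consecutive _ hkj.le (by omega : j ≤ n),
      ← Finset.sum_Ico_consecutive _ hjl.le hln.le]
    ring
  have hPR : Disjoint (range P) (range R) := by
    refine disjoint_left.2 fun z hzP hzR => ?_
    obtain ⟨s, hs1, hs2, hs⟩ := hP z hzP
    obtain ⟨t, ht1, ht2, ht⟩ := hR z hzR
    refine disjoint_left.1 (cdisj s t (by omega) (by omega) fun p q hp hq h => ?_) hs ht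
    have := hv' p q (by omega) (by omega) h
    omega
  have hQS : Disjoint (range Q) (range S) := by
    refine disjoint_left.2 fun z hzQ hzS => ?_
    obtain ⟨s, hs1, hs2, hs⟩ := hQ z hzQ
    obtain ⟨t, ht1, ht2, ht⟩ := hS' z hzS
    refine disjoint_left.1 (cdisj s t (by omega) (by omega) fun p q hp hq h => ?_) hs ht
    have := hv' p q (by omega) (by omega) h
    omega
  have hγδ : Disjoint (range γ) (range δ) := by
    rw [hγr, hδr]
    refine disjoint_carc (fun w h1 h2 => ?_) hcr
    rcases Sym2.mem_iff.1 h1 with rfl | rfl <;> rcases Sym2.mem_iff.1 h2 with h2 | h2 <;>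
    · have := hv' _ _ (by omega) (by omega) h2
      omega
  have hγ := chord i j (by omega) (by omega) (by omega) he
  have hδ := chord k l (by omega) (by omega) (by omega) hf
  have mγ := midpoint_mem_cOpenArc (D := D) ⟨s(v i, v j), he⟩
  have mδ := midpoint_mem_cOpenArc (D := D) ⟨s(v k, v l), hf⟩
  rw [← total _ (hγ _ mγ), ← total _ (hδ _ mδ)]
  rw [← hγo] at hγ mγ
  rw [← hδo] at hδ mδ
  obtain ⟨s, hs, hsm⟩ := mγ
  obtain ⟨t, ht, htm⟩ := mδ
  rw [← hsm, ← htm]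
  exact exists_odd_add_logIncrement_of_chords P Q R S γ δ hPR hQS hγδ
    (fun r hr => off _ (hγ _ ⟨r, hr, rfl⟩)) (fun r hr => off _ (hδ _ ⟨r, hr, rfl⟩)) hs ht

/-! ### The book embedding -/

/-- The crossing pairs of a 1-planar drawing form a matching, so the edges have a 2-colouring in
which crossing edges get different colours. -/
theorem IsOnePlanar.exists_coloring (hD : D.IsOnePlanar) :
    ∃ m : G.edgeSet → Prop, ∀ e f x, D.CrossAt e f x → ¬ (m e ↔ m f) := by
  -- Colour an edge by whether it precedes its crossing partner in some well-order.
  refine ⟨fun e => ∃ f x, D.CrossAt e f x ∧ WellOrderingRel e f, ?_⟩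
  have key : ∀ e f x, D.CrossAt e f x → WellOrderingRel e f →
      ¬ ∃ g y, D.CrossAt f g y ∧ WellOrderingRel f g := by
    rintro e f x h hlt ⟨g, y, hg, hlt'⟩
    obtain ⟨rfl, -⟩ := hD f e g x y h.symm hg
    exact asymm hlt hlt'
  intro e f x h hiff
  rcases trichotomous_of WellOrderingRel e f with hlt | heq | hlt
  · exact key e f x h hlt (hiff.1 ⟨f, x, h, hlt⟩)
  · exact h.1 heq
  · exact key f e x h.symm hlt (hiff.2 ⟨e, x, h.symm, hlt⟩)

end PlaneDrawing

theorem mainTheorem3 {V : Type*} [Fintype V] [DecidableEq V] (G : SimpleGraph V)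
    (D : PlaneDrawing G) (hD : D.IsOnePlanar)
    (hH : ∃ (a : V) (p : D.skeleton.Walk a a), p.IsHamiltonianCycle) :
    Nonempty (BookEmbedding G 4) := by
  classical
  obtain ⟨a, p, hp⟩ := hH
  set n := p.length with hn
  have hn3 : 3 ≤ n := hp.isCycle.three_le_length
  have hinj : ∀ i j, i < n → j < n → p.getVert i = p.getVert j → i = j := fun i j hi hj h =>
    hp.isCycle.getVert_injOn' (by simp only [mem_ofPred_eq]; omega)
      (by simp only [mem_ofPred_eq]; omega) h
  have hclosed : p.getVert n = p.getVert 0 := by simp [hn]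
  have hskel : ∀ t < n, D.skeleton.Adj (p.getVert t) (p.getVert (t + 1)) :=
    fun t ht => p.adj_getVert_succ ht
  have adj : ∀ t < n, G.Adj (p.getVert t) (p.getVert (t + 1)) := fun t ht =>
    (SimpleGraph.deleteEdges_adj.1 (hskel t ht)).1
  have unc : ∀ t (h : t < n), ¬ D.IsCrossed ⟨s(p.getVert t, p.getVert (t + 1)), adj t h⟩ :=
    fun t ht h => (SimpleGraph.deleteEdges_adj.1 (hskel t ht)).2 ⟨_, h, rfl⟩
  have hidx : ∀ u, ∃ i < n, p.getVert i = u := by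
    intro u
    obtain ⟨i, hi, hin⟩ := SimpleGraph.Walk.mem_support_iff_exists_getVert.1 (hp.mem_support u)
    rcases hin.lt_or_eq with h | rfl
    · exact ⟨i, h, hi⟩
    · exact ⟨0, by omega, hclosed ▸ hi⟩
  choose idx idx_lt getVert_idx using hidx
  have idx_inj : Function.Injective idx := fun u w h => by
    rw [← getVert_idx u, ← getVert_idx w, h]
  have hpath : ∀ t, ∃ γ : Path (D.cpoint (p.getVert t)) (D.cpoint (p.getVert (t + 1))),
      ∀ h : t < n, range γ = D.carc ⟨s(p.getVert t, p.getVert (t + 1)), adj t h⟩ := by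
    intro t
    by_cases h : t < n
    · obtain ⟨γ, hγ, -⟩ := D.exists_path (adj t h)
      exact ⟨γ, fun _ => hγ⟩
    · exact ⟨PathConnectedSpace.somePath _ _, fun h' => absurd h' h⟩
  choose c hc using hpath
  obtain ⟨m, hm⟩ := hD.exists_coloring
  -- An edge lies on the even side if the cycle winds an even number of times around its midpoint.
  let side (e : G.edgeSet) : Prop := ∃ r : ℤ, Even r ∧
    ∑ t ∈ Finset.range n, logIncrement (c t) (D.midpoint e) = r * (2 * Real.pi * Complex.I)
  let L : LinearOrder V := LinearOrder.lift' idx idx_inj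
  have hL : ∀ u w, L.lt u w ↔ idx u < idx w := fun u w => Iff.rfl
  have hpi : (2 * Real.pi * Complex.I : ℂ) ≠ 0 := by simp [Real.pi_ne_zero]
  have key : ∀ (e f : G.edgeSet) (u w x y : V), (e : Sym2 V) = s(u, w) → (f : Sym2 V) = s(x, y) →
      idx u < idx x → idx x < idx w → idx w < idx y → (∀ z, ¬ D.CrossAt e f z) →
      ¬ (side e ↔ side f) := by
    rintro ⟨e, he⟩ ⟨f, hf⟩ u w x y rfl rfl h1 h2 h3 hcr hside
    obtain ⟨i, hi⟩ : ∃ i, idx u = i := ⟨_, rfl⟩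
    obtain ⟨k, hk⟩ : ∃ i, idx x = i := ⟨_, rfl⟩
    obtain ⟨j, hj⟩ : ∃ i, idx w = i := ⟨_, rfl⟩
    obtain ⟨l, hl⟩ : ∃ i, idx y = i := ⟨_, rfl⟩
    have hln := idx_lt y
    rw [hi, hk] at h1
    rw [hk, hj] at h2
    rw [hj, hl] at h3
    rw [hl] at hln
    obtain rfl : p.getVert i = u := hi ▸ getVert_idx u
    obtain rfl : p.getVert k = x := hk ▸ getVert_idx x
    obtain rfl : p.getVert j = w := hj ▸ getVert_idx w
    obtain rfl : p.getVert l = y := hl ▸ getVert_idx y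
    obtain ⟨r, r', hodd, hr, hr'⟩ := PlaneDrawing.exists_odd_add_winding_of_chords hclosed hinj adj
      unc c hc h1 h2 h3 hln he hf hcr
    have side_iff {g : G.edgeSet} {q : ℤ} (hq : ∑ t ∈ Finset.range n,
        logIncrement (c t) (D.midpoint g) = q * (2 * Real.pi * Complex.I)) :
        side g ↔ Even q := by
      refine ⟨fun ⟨q', hq', h⟩ => ?_, fun h => ⟨q, h, hq⟩⟩
      have := mul_right_cancel₀ hpi (hq.symm.trans h)
      rwa [Int.cast_injective this]
    rw [side_iff hr, side_iff hr'] at hside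
    rw [← Int.not_even_iff_odd, Int.even_add] at hodd
    exact hodd hside
  let col (e : G.edgeSet) : Bool × Bool := (decide (side e), decide (m e))
  have e4 : Bool × Bool ≃ Fin 4 := Fintype.equivFinOfCardEq (by simp)
  refine ⟨⟨L, fun e => e4 (col e), fun e f hpage htwist => ?_⟩⟩
  have hcol : col e = col f := e4.injective hpage
  simp only [col, Prod.mk.injEq, decide_eq_decide] at hcol
  have hcr : ∀ z, ¬ D.CrossAt e f z := fun z hz => hm e f z hz hcol.2
  obtain ⟨u, w, x, y, he, hf, ⟨h1, h2, h3⟩ | ⟨h1, h2, h3⟩⟩ := htwist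
  · exact key e f u w x y he hf h1 h2 h3 hcr hcol.1
  · exact key f e x y u w hf he h1 h2 h3 (fun z hz => hcr z hz.symm) hcol.1.symm
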